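/- Let $K$ be a field (for instance $\mathbb{R}$, $\mathbb{C}$, or a field of rational functions in which $a,b,t$ are indeterminates) and let $a,b,t\in K$ satisfy $b\neq 0$ and $(n+1)a+t\neq 0$ for all integers $n\ge 0$. Let $f(z)\in K[[z]]$ be the unique formal power series with $$f(z)=1+az\,f(z)+bz^3f(z)^2,$$ and define $C(n,3,a,b,t)$ by $$\sum_{n\ge 0}C(n,3,a,b,t)\,z^n=\frac{f(z)}{1-tz\,f(z)}.$$ For a sequence $\mu=(\mu_n)_{n\ge0}$ in $K$ let $F_\mu$ be the linear functional on $K[z]$ with $F_\mu(z^n)=\mu_n$. Say that sequences $s,t$ (indexed by $n\ge 0$) are Favard recurrence coefficients of $\mu$ if there are monic polynomials $p_n$ with $\deg p_n=n$, with $F_\mu(p_mp_n)=0$ for $m\ne n$ and $F_\mu(p_n^2)\neq0$, such that $p_0=1$, $p_1=z-s(0)$ and $$p_n(z)=(z-s(n-1))\,p_{n-1}(z)-t(n-2)\,p_{n-2}(z)\qquad(n\ge 2).$$ (i) For every constant $c\in K$, $c\ne0$ (in particular for $c=a$ if $a\neq 0$), the sequence $\mu_n=C(n+1,3,a,b,t)/c$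 has nonvanishing Hankel determinants, $\det(\mu_{i+j})_{i,j=0}^{n-1}\neq0$ for all $n\ge0$, and it has exactly one pair of sequences $s(n),t(n)$ of Favard recurrence coefficients. These are, for $n\ge 0$, $$s(3n)=(n+1)a+t,\qquad s(3n+1)=a,\qquad s(3n+2)=-(n+1)a-t,$$ $$t(3n)=\frac{b}{(n+1)a+t},\qquad t(3n+1)=-\frac{b}{(n+1)a+t},\qquad t(3n+2)=-\bigl((n+1)a+t\bigr)\bigl((n+2)a+t\bigr).$$ (ii) One has $C(1,3,a,b,t)=a+t$, and for the normalized sequence $C(n+1,3,a,b,t)/(a+t)$, whose first term is $1$, the same sequences are the only $s(n),t(n)$ such that the array $v(n,j)$ defined for $n,j\ge 0$ by $v(0,j)=[j=0]$ and $$v(n,0)=s(0)v(n-1,0)+t(0)v(n-1,1),\qquad v(n,j)=v(n-1,j-1)+s(j)v(n-1,j)+t(j)v(n-1,j+1)\quad(n,j\ge1)$$ satisfies $v(n,0)=C(n+1,3,a,b,t)/(a+t)$ for all $n\ge0$. (Here the parameter $t$ and the sequence $t(n)$ are different objects.) -/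

import Mathlib

open Polynomial

noncomputable section

/-- The coefficients `c(n, m, a, b)` (for `m ≥ 1`) of the unique power series `f` with
`f = 1 + a z f + b z ^ m f ^ 2`, computed by comparing coefficients in this equation. -/
def catCoeff {K : Type*} [Field K] (m : ℕ) (a b : K) : ℕ → K
  | 0 => 1
  | n + 1 => a * catCoeff m a b n +
      if _h : 0 < m ∧ m ≤ n + 1 then
        b * ∑ i : Fin (n + 1 - m + 1),
          catCoeff m a b i.1 * catCoeff m a b (n + 1 - m - i.1)
      else 0
  termination_by n => n
  decreasing_by all_goals omega

/-- The generating function `f_m(z, a, b) = ∑ c(n, m, a, b) z ^ n`. -/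
def catSeries {K : Type*} [Field K] (m : ℕ) (a b : K) : PowerSeries K :=
  PowerSeries.mk (catCoeff m a b)

/-- The generating function `F_m(z, a, b, t) = f_m(z, a, b) / (1 - t z f_m(z, a, b))`; the
denominator has constant term `1`, so the inverse is the true inverse of power series. -/
def genCatSeries {K : Type*} [Field K] (m : ℕ) (a b t : K) : PowerSeries K :=
  catSeries m a b * (1 - PowerSeries.C t * PowerSeries.X * catSeries m a b)⁻¹

/-- The numbers `C(n, m, a, b, t)`, the coefficients of `F_m(z, a, b, t)`. -/
def genCat {K : Type*} [Field K] (n m : ℕ) (a b t : K) : K :=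
  PowerSeries.coeff n (genCatSeries m a b t)

/-- The series `catSeries` does satisfy its defining quadratic equation. -/
theorem catSeries_eq {K : Type*} [Field K] (m : ℕ) (hm : 1 ≤ m) (a b : K) :
    catSeries m a b = 1 + PowerSeries.C a * PowerSeries.X * catSeries m a b
      + PowerSeries.C b * PowerSeries.X ^ m * catSeries m a b ^ 2 := by
  ext n
  cases n with
  | zero =>
    have hm' : m ≠ 0 := by omega
    simp [catSeries, catCoeff, mul_assoc, hm']
  | succ n =>
    rw [map_add, map_add, mul_assoc, mul_assoc, PowerSeries.coeff_C_mul, PowerSeries.coeff_C_mul,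
      PowerSeries.coeff_succ_X_mul, PowerSeries.coeff_X_pow_mul']
    simp only [catSeries, PowerSeries.coeff_mk]
    rw [catCoeff]
    by_cases h : m ≤ n + 1
    · have h' : 0 < m ∧ m ≤ n + 1 := ⟨hm, h⟩
      rw [dif_pos h', if_pos h, sq, PowerSeries.coeff_mul,
        Finset.Nat.sum_antidiagonal_eq_sum_range_succ_mk, Finset.sum_range]
      simp [PowerSeries.coeff_one]
    · rw [dif_neg (fun h' => h h'.2), if_neg h]
      simp [PowerSeries.coeff_one]

/-- The series `genCatSeries` is the quotient that it is meant to be. -/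
theorem genCatSeries_mul {K : Type*} [Field K] (m : ℕ) (a b t : K) :
    genCatSeries m a b t * (1 - PowerSeries.C t * PowerSeries.X * catSeries m a b)
      = catSeries m a b := by
  rw [genCatSeries, mul_assoc, PowerSeries.inv_mul_cancel, mul_one]
  simp

/-- The Hankel determinant `det (μ (i + j))`, `0 ≤ i, j < n`, which is `1` for `n = 0`. -/
def hankelDet {K : Type*} [Field K] (μ : ℕ → K) (n : ℕ) : K :=
  (Matrix.of fun i j : Fin n => μ (i.1 + j.1)).det

/-- The linear functional on polynomials with moments `μ`, that is, `z ^ n ↦ μ n`. -/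
def momentFunctional {K : Type*} [Field K] (μ : ℕ → K) : K[X] →ₗ[K] K :=
  Polynomial.lsum fun n => LinearMap.mulRight K (μ n)

theorem momentFunctional_X_pow {K : Type*} [Field K] (μ : ℕ → K) (n : ℕ) :
    momentFunctional μ (X ^ n) = μ n := by
  rw [X_pow_eq_monomial]
  simp [momentFunctional, Polynomial.lsum_apply]

/-- `p` is a sequence of monic orthogonal polynomials with respect to the functional `F`:
`deg (p n) = n`, and `F (p m * p n) = r n * [m = n]` with `r n ≠ 0`. -/
structure IsMonicOrthogonal {K : Type*} [Field K] (F : K[X] →ₗ[K] K) (p : ℕ → K[X]) : Prop where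
  monic : ∀ n, (p n).Monic
  natDegree_eq : ∀ n, (p n).natDegree = n
  orthogonal : ∀ m n, m ≠ n → F (p m * p n) = 0
  norm_ne_zero : ∀ n, F (p n * p n) ≠ 0

/-- `s, t` are Favard recurrence coefficients of the sequence `μ`: the monic orthogonal
polynomials with moments `μ` exist and satisfy
`p n = (z - s (n - 1)) p (n - 1) - t (n - 2) p (n - 2)` for `n ≥ 1`, where `p (-1) = 0`. -/
def IsFavardCoeff {K : Type*} [Field K] (μ s t : ℕ → K) : Prop :=
  ∃ p : ℕ → K[X], IsMonicOrthogonal (momentFunctional μ) p ∧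
    p 0 = 1 ∧ p 1 = X - C (s 0) ∧
    ∀ n, p (n + 2) = (X - C (s (n + 1))) * p (n + 1) - C (t n) * p n

/-- The array `v(n, j)` with `v(0, j) = [j = 0]`,
`v(n, 0) = s(0) v(n - 1, 0) + t(0) v(n - 1, 1)` and
`v(n, j) = v(n - 1, j - 1) + s(j) v(n - 1, j) + t(j) v(n - 1, j + 1)`. -/
def favardArray {K : Type*} [Field K] (s t : ℕ → K) : ℕ → ℕ → K
  | 0, j => if j = 0 then 1 else 0
  | n + 1, 0 => s 0 * favardArray s t n 0 + t 0 * favardArray s t n 1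
  | n + 1, j + 1 => favardArray s t n j + s (j + 1) * favardArray s t n (j + 1)
      + t (j + 1) * favardArray s t n (j + 2)

/-- The explicit values of `s` and `t` at the indices `3n`, `3n + 1`, `3n + 2`. -/
def HasModThreeValues {K : Type*} [Field K] (a b τ : K) (s t : ℕ → K) : Prop :=
  ∀ n : ℕ,
    s (3 * n) = (n + 1) * a + τ ∧
    s (3 * n + 1) = a ∧
    s (3 * n + 2) = -((n + 1) * a) - τ ∧
    t (3 * n) = b / ((n + 1) * a + τ) ∧
    t (3 * n + 1) = -(b / ((n + 1) * a + τ)) ∧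
    t (3 * n + 2) = -(((n + 1) * a + τ) * ((n + 2) * a + τ))

end

/-! The series `∑ C(n+1,3,a,b,t) zⁿ` has an explicit J-fraction. Write `f` for `catSeries 3 a b` and
`u = (n+1)a + t`. The `k`-th tail `R k` of the fraction is, for `k = 3n, 3n+1, 3n+2`,

`f (1 + (b/u) z² f) / (1 - (u-a) z f)`,  `f / (1 + (b/u) z² f)`,  `1 - u z f`,

and the relations `R k = 1 + s k z (R k) + t k z² (R k) (R (k+1))` are consequences of
`f = 1 + a z f + b z³ f²` (`tailSeries_eq`). Since `∑ C(n+1,3,a,b,t) zⁿ = (a+t) R 0`, and the column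
`j` of the Favard array has generating function `zʲ R 0 ⋯ R j` (`favardArray_eq_coeff`), the
given `s, t` produce the moments in column `0`.

The rest holds for arbitrary `s, t`. If the moments are `μ n = d v(n, 0)` and `p` solves the
three-term recurrence, then `F_μ (zⁿ p m) = d t(0) ⋯ t(m-1) v(n, m)` (`moment_X_pow_mul_favardPoly`);
as `v(n, m)` is unitriangular, the `p m` are orthogonal with norms `d t(0) ⋯ t(m-1)`. The
Hankel determinants are the products of these norms, so they do not vanish for the given `t`, and
conversely they force every `t`-product of a competing array to be nonzero. Uniqueness therefore
reduces in both parts to the uniqueness of monic orthogonal polynomials. -/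

noncomputable section

variable {K : Type*} [Field K]

/-- The solution of the three-term recurrence with coefficients `s, t`. -/
def favardPoly (s t : ℕ → K) : ℕ → K[X]
  | 0 => 1
  | 1 => X - C (s 0)
  | n + 2 => (X - C (s (n + 1))) * favardPoly s t (n + 1) - C (t n) * favardPoly s t n

theorem favardPoly_monic_natDegree (s t : ℕ → K) (n : ℕ) :
    (favardPoly s t n).Monic ∧ (favardPoly s t n).natDegree = n := by
  induction n using Nat.twoStepInduction with
  | zero => simp [favardPoly]
  | one => exact ⟨monic_X_sub_C _, natDegree_X_sub_C _⟩
  | more n ih0 ih1 =>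
    have hm : ((X - C (s (n + 1))) * favardPoly s t (n + 1)).Monic := (monic_X_sub_C _).mul ih1.1
    have hd : ((X - C (s (n + 1))) * favardPoly s t (n + 1)).natDegree = n + 2 := by
      rw [(monic_X_sub_C _).natDegree_mul ih1.1, natDegree_X_sub_C, ih1.2]; omega
    have hlt : (C (t n) * favardPoly s t n).degree <
        ((X - C (s (n + 1))) * favardPoly s t (n + 1)).degree := by
      rw [degree_eq_natDegree hm.ne_zero, hd]
      refine lt_of_le_of_lt degree_le_natDegree ?_
      have := natDegree_C_mul_le (t n) (favardPoly s t n)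
      rw [ih0.2] at this
      exact_mod_cast (by omega : (C (t n) * favardPoly s t n).natDegree < n + 2)
    refine ⟨hm.sub_of_left hlt, ?_⟩
    rw [favardPoly, natDegree_eq_of_degree_eq (degree_sub_eq_left_of_degree_lt hlt), hd]

/-! ### The Favard array -/

theorem favardArray_eq_zero (s t : ℕ → K) {n m : ℕ} (h : n < m) : favardArray s t n m = 0 := by
  induction n generalizing m with
  | zero => simp [favardArray, Nat.ne_of_gt h]
  | succ n ih =>
    obtain ⟨m, rfl⟩ : ∃ k, m = k + 1 := ⟨m - 1, by omega⟩
    rw [favardArray, ih (by omega), ih (by omega), ih (by omega)]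
    ring

theorem favardArray_self (s t : ℕ → K) (n : ℕ) : favardArray s t n n = 1 := by
  induction n with
  | zero => simp [favardArray]
  | succ n ih =>
    rw [favardArray, ih, favardArray_eq_zero s t (by omega), favardArray_eq_zero s t (by omega)]
    ring

/-- Column `j` of the array has generating function `zʲ R 0 ⋯ R j`, where the `R k` are the tails
of the J-fraction with coefficients `s, t`. -/
theorem favardArray_eq_coeff {s t : ℕ → K} {R : ℕ → PowerSeries K}
    (hR : ∀ k, R k = 1 + PowerSeries.C (s k) * PowerSeries.X * R k
      + PowerSeries.C (t k) * PowerSeries.X ^ 2 * R k * R (k + 1)) (n j : ℕ) :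
    favardArray s t n j =
      PowerSeries.coeff n (PowerSeries.X ^ j * ∏ i ∈ Finset.range (j + 1), R i) := by
  set W : ℕ → PowerSeries K := fun j => PowerSeries.X ^ j * ∏ i ∈ Finset.range (j + 1), R i
    with hW
  have hW0 : W 0 = 1 + PowerSeries.X * (PowerSeries.C (s 0) * W 0 + PowerSeries.C (t 0) * W 1) := by
    simp only [hW, Finset.prod_range_succ, Finset.prod_range_zero]
    linear_combination hR 0
  have hW1 (j : ℕ) : W (j + 1) = PowerSeries.X * (W j + PowerSeries.C (s (j + 1)) * W (j + 1)
      + PowerSeries.C (t (j + 1)) * W (j + 2)) := by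
    simp only [hW]
    rw [Finset.prod_range_succ _ (j + 2), Finset.prod_range_succ _ (j + 1)]
    linear_combination
      (PowerSeries.X ^ (j + 1) * ∏ i ∈ Finset.range (j + 1), R i) * hR (j + 1)
  change favardArray s t n j = PowerSeries.coeff n (W j)
  induction n generalizing j with
  | zero =>
    cases j with
    | zero => rw [hW0]; simp [favardArray]
    | succ j => rw [hW1]; simp [favardArray]
  | succ n ih =>
    cases j with
    | zero =>
      rw [hW0, favardArray, map_add, PowerSeries.coeff_succ_X_mul, ih, ih]
      simp [PowerSeries.coeff_one]
    | succ j =>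
      rw [hW1, favardArray, PowerSeries.coeff_succ_X_mul, ih, ih, ih]
      simp

/-! ### Orthogonality -/

/-- The three-term recurrence for `p m` is the transpose of the recurrence for the array, which is
why the array lists the values `F (zⁿ p m)` up to the norm of `p m`. -/
theorem moment_X_pow_mul_favardPoly {μ s t : ℕ → K} {d : K}
    (hμ : ∀ n, μ n = d * favardArray s t n 0) (m n : ℕ) :
    momentFunctional μ (X ^ n * favardPoly s t m) =
      d * (∏ i ∈ Finset.range m, t i) * favardArray s t n m := by
  have key (c e : K) (p q : K[X]) (n : ℕ) :
      momentFunctional μ (X ^ n * ((X - C c) * p - C e * q)) =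
        momentFunctional μ (X ^ (n + 1) * p) - c * momentFunctional μ (X ^ n * p)
          - e * momentFunctional μ (X ^ n * q) := by
    rw [show X ^ n * ((X - C c) * p - C e * q) =
      X ^ (n + 1) * p - c • (X ^ n * p) - e • (X ^ n * q) by
        simp only [smul_eq_C_mul]; ring]
    simp
  induction m using Nat.twoStepInduction generalizing n with
  | zero => simp [favardPoly, momentFunctional_X_pow, hμ]
  | one =>
    have := key (s 0) 0 1 0 n
    simp only [mul_one, map_zero, mul_zero, sub_zero, momentFunctional_X_pow] at this
    rw [favardPoly, this, hμ, hμ, favardArray]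
    simp only [Finset.prod_range_succ, Finset.prod_range_zero]
    ring
  | more m ih0 ih1 =>
    rw [favardPoly, key, ih1, ih1, ih0, favardArray, Finset.prod_range_succ _ (m + 1),
      Finset.prod_range_succ _ m]
    ring

theorem moment_mul_favardPoly_of_degree_lt {μ s t : ℕ → K} {d : K}
    (hμ : ∀ n, μ n = d * favardArray s t n 0) {m : ℕ} {q : K[X]} (hq : q.degree < m) :
    momentFunctional μ (q * favardPoly s t m) = 0 := by
  rw [q.as_sum_range_C_mul_X_pow, Finset.sum_mul, map_sum]
  refine Finset.sum_eq_zero fun i _ => ?_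
  rw [mul_assoc, ← smul_eq_C_mul, map_smul, moment_X_pow_mul_favardPoly hμ]
  by_cases hi : i < m
  · rw [favardArray_eq_zero s t hi]; simp
  · rw [coeff_eq_zero_of_degree_lt (hq.trans_le (by exact_mod_cast not_lt.mp hi)), zero_smul]

theorem moment_favardPoly_mul_of_ne {μ s t : ℕ → K} {d : K}
    (hμ : ∀ n, μ n = d * favardArray s t n 0) {m n : ℕ} (h : m ≠ n) :
    momentFunctional μ (favardPoly s t m * favardPoly s t n) = 0 := by
  have hd (k : ℕ) : (favardPoly s t k).degree = k := by
    have := favardPoly_monic_natDegree s t k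
    rw [degree_eq_natDegree this.1.ne_zero, this.2]
  rcases h.lt_or_gt with h | h
  · exact moment_mul_favardPoly_of_degree_lt hμ (by rw [hd]; exact_mod_cast h)
  · rw [mul_comm]
    exact moment_mul_favardPoly_of_degree_lt hμ (by rw [hd]; exact_mod_cast h)

theorem moment_favardPoly_mul_self {μ s t : ℕ → K} {d : K}
    (hμ : ∀ n, μ n = d * favardArray s t n 0) (m : ℕ) :
    momentFunctional μ (favardPoly s t m * favardPoly s t m) =
      d * ∏ i ∈ Finset.range m, t i := by
  obtain ⟨hm, hd⟩ := favardPoly_monic_natDegree s t m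
  have h0 : (favardPoly s t m - X ^ m).degree < (m : WithBot ℕ) := by
    have h := degree_sub_lt_left (p := favardPoly s t m) (q := X ^ m)
      (by rw [degree_eq_natDegree hm.ne_zero, hd, degree_X_pow]) hm.ne_zero (by simp [hm])
    rwa [degree_eq_natDegree hm.ne_zero, hd] at h
  have h1 := moment_mul_favardPoly_of_degree_lt hμ h0
  rw [sub_mul, map_sub, moment_X_pow_mul_favardPoly hμ, favardArray_self, sub_eq_zero] at h1
  rw [h1, mul_one]

theorem favardPoly_isMonicOrthogonal {μ s t : ℕ → K} {d : K}
    (hμ : ∀ n, μ n = d * favardArray s t n 0) (hn : ∀ n, d * ∏ i ∈ Finset.range n, t i ≠ 0) :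
    IsMonicOrthogonal (momentFunctional μ) (favardPoly s t) where
  monic n := (favardPoly_monic_natDegree s t n).1
  natDegree_eq n := (favardPoly_monic_natDegree s t n).2
  orthogonal _ _ h := moment_favardPoly_mul_of_ne hμ h
  norm_ne_zero n := by rw [moment_favardPoly_mul_self hμ]; exact hn n

theorem isFavardCoeff_of_favardArray {μ s t : ℕ → K} {d : K}
    (hμ : ∀ n, μ n = d * favardArray s t n 0) (hn : ∀ n, d * ∏ i ∈ Finset.range n, t i ≠ 0) :
    IsFavardCoeff μ s t :=
  ⟨favardPoly s t, favardPoly_isMonicOrthogonal hμ hn, rfl, rfl, fun _ => rfl⟩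

/-- The change of basis from monomials to the orthogonal polynomials is unitriangular, and it
diagonalises the Hankel matrix. -/
theorem hankelDet_eq_prod (μ : ℕ → K) {p : ℕ → K[X]} (hm : ∀ n, (p n).Monic)
    (hd : ∀ n, (p n).natDegree = n)
    (ho : ∀ m n, m ≠ n → momentFunctional μ (p m * p n) = 0) (n : ℕ) :
    hankelDet μ n = ∏ i ∈ Finset.range n, momentFunctional μ (p i * p i) := by
  let P : Matrix (Fin n) (Fin n) K := Matrix.of fun i j => (p j).coeff i
  have hP : P.det = 1 :=
    Matrix.det_matrixOfPolynomials (fun i : Fin n => p i) (fun i => hd i) (fun i => hm i)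
  have hsum (i : Fin n) : p i = ∑ k : Fin n, (p i).coeff k • (X : K[X]) ^ (k : ℕ) := by
    rw [Finset.sum_fin_eq_sum_range]
    conv_lhs => rw [(p i).as_sum_range_C_mul_X_pow' (n := n) (by rw [hd]; exact i.2)]
    refine Finset.sum_congr rfl fun k hk => ?_
    rw [dif_pos (Finset.mem_range.mp hk), smul_eq_C_mul]
  have hdiag : P.transpose * (Matrix.of fun i j : Fin n => μ (i.1 + j.1)) * P =
      Matrix.diagonal fun i : Fin n => momentFunctional μ (p i * p i) := by
    ext i j
    have hij : momentFunctional μ (p i * p j) =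
        (P.transpose * (Matrix.of fun i j : Fin n => μ (i.1 + j.1)) * P) i j := by
      conv_lhs => rw [hsum i, hsum j]
      simp only [Matrix.mul_apply, Matrix.transpose_apply, Matrix.of_apply, P, Finset.sum_mul,
        Finset.mul_sum, map_sum, smul_mul_smul_comm, map_smul, ← pow_add, momentFunctional_X_pow,
        smul_eq_mul]
      exact Finset.sum_congr rfl fun _ _ => Finset.sum_congr rfl fun _ _ => by ring
    rw [← hij]
    by_cases h : i = j
    · rw [h, Matrix.diagonal_apply_eq]
    · rw [Matrix.diagonal_apply_ne _ h, ho _ _ (fun h' => h (Fin.ext h'))]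
  have hdet := congrArg Matrix.det hdiag
  rw [Matrix.det_mul, Matrix.det_mul, Matrix.det_transpose, hP, Matrix.det_diagonal, one_mul,
    mul_one] at hdet
  rw [hankelDet, hdet, Finset.prod_range]

/-! ### Uniqueness -/

theorem IsMonicOrthogonal.moment_mul_of_degree_lt {F : K[X] →ₗ[K] K} {p : ℕ → K[X]}
    (hp : IsMonicOrthogonal F p) {n : ℕ} (m : ℕ) {q : K[X]} (hq : q.degree < m) (hmn : m ≤ n) :
    F (q * p n) = 0 := by
  induction m generalizing q with
  | zero =>
    obtain rfl : q = 0 := by simpa using hq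
    simp
  | succ m ih =>
    -- subtracting a multiple of `p m` lowers the degree
    have hpd : (p m).degree = m := by
      rw [degree_eq_natDegree (hp.monic m).ne_zero, hp.natDegree_eq]
    have hc : (p m).coeff m = 1 := by
      simpa [hp.natDegree_eq] using (hp.monic m).coeff_natDegree
    have hr : (q - C (q.coeff m) * p m).degree < m := by
      rw [degree_lt_iff_coeff_zero]
      intro k hk
      rcases hk.eq_or_lt with rfl | hk
      · simp [hc]
      · rw [coeff_sub, coeff_C_mul, coeff_eq_zero_of_degree_lt (hpd.trans_lt (by exact_mod_cast hk)),
          coeff_eq_zero_of_degree_lt (hq.trans_le (by exact_mod_cast hk))]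
        simp
    have h := ih hr (by omega)
    rw [sub_mul, map_sub, mul_assoc, ← smul_eq_C_mul, map_smul,
      hp.orthogonal m n (by omega), smul_zero, sub_zero] at h
    exact h

theorem IsMonicOrthogonal.eq {F : K[X] →ₗ[K] K} {p q : ℕ → K[X]}
    (hp : IsMonicOrthogonal F p) (hq : IsMonicOrthogonal F q) : p = q := by
  funext n
  have hpd (k : ℕ) : (p k).degree = k := by
    rw [degree_eq_natDegree (hp.monic k).ne_zero, hp.natDegree_eq]
  have hqd (k : ℕ) : (q k).degree = k := by
    rw [degree_eq_natDegree (hq.monic k).ne_zero, hq.natDegree_eq]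
  have hdeg : (p n - q n).degree < n := by
    rw [← hpd n]
    exact degree_sub_lt_left (by rw [hpd, hqd]) (hp.monic n).ne_zero
      (by rw [(hp.monic n).leadingCoeff, (hq.monic n).leadingCoeff])
  by_contra hne
  -- a nonzero difference `r` of degree `k < n` would give `F (r * p k) ≠ 0`, although `r` is
  -- orthogonal to all polynomials of degree less than `n`
  set r := p n - q n with hr
  have hr0 : r ≠ 0 := sub_ne_zero.mpr hne
  set k := r.natDegree with hk
  have hrd : r.degree = k := degree_eq_natDegree hr0
  have hkn : k < n := by rw [hrd] at hdeg; exact_mod_cast hdeg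
  have h1 : F (r * p k) = 0 := by
    have hlt : (p k).degree < n := by rw [hpd]; exact_mod_cast hkn
    rw [mul_comm, hr, mul_sub, map_sub, hp.moment_mul_of_degree_lt n hlt le_rfl,
      hq.moment_mul_of_degree_lt n hlt le_rfl, sub_zero]
  have h2 : (r - C r.leadingCoeff * p k).degree < k := by
    rw [← hrd]
    refine degree_sub_lt_left ?_ hr0 ?_
    · rw [degree_C_mul (leadingCoeff_ne_zero.mpr hr0), hpd, hrd]
    · rw [leadingCoeff_mul, leadingCoeff_C, (hp.monic k).leadingCoeff, mul_one]
  have h3 := hp.moment_mul_of_degree_lt k h2 le_rfl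
  rw [sub_mul, map_sub, h1, mul_assoc, ← smul_eq_C_mul, map_smul, zero_sub, neg_eq_zero,
    smul_eq_mul] at h3
  exact mul_ne_zero (leadingCoeff_ne_zero.mpr hr0) (hp.norm_ne_zero k) h3

theorem IsFavardCoeff.eq {μ s t s' t' : ℕ → K} (h : IsFavardCoeff μ s t)
    (h' : IsFavardCoeff μ s' t') : s = s' ∧ t = t' := by
  obtain ⟨p, hp, -, hp1, hrec⟩ := h
  obtain ⟨q, hq, -, hq1, hrec'⟩ := h'
  obtain rfl := hp.eq hq
  have hc (n : ℕ) : (p n).coeff n = 1 := by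
    simpa [hp.natDegree_eq] using (hp.monic n).coeff_natDegree
  have hst (n : ℕ) : s (n + 1) = s' (n + 1) ∧ t n = t' n := by
    have e : C (s (n + 1) - s' (n + 1)) * p (n + 1) + C (t n - t' n) * p n = 0 := by
      rw [C_sub, C_sub]
      linear_combination hrec n - hrec' n
    have hs : s (n + 1) = s' (n + 1) := by
      have := congrArg (coeff · (n + 1)) e
      simp only [coeff_add, coeff_C_mul, hc, coeff_zero,
        coeff_eq_zero_of_natDegree_lt (show (p n).natDegree < n + 1 by
          rw [hp.natDegree_eq]; omega), mul_one, mul_zero, add_zero] at this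
      exact sub_eq_zero.mp this
    refine ⟨hs, ?_⟩
    have := congrArg (coeff · n) e
    simp only [hs, sub_self, C_0, zero_mul, zero_add, coeff_C_mul, hc, mul_one, coeff_zero] at this
    exact sub_eq_zero.mp this
  refine ⟨?_, funext fun n => (hst n).2⟩
  funext n
  cases n with
  | zero => exact C_injective (sub_right_injective (hp1.symm.trans hq1))
  | succ n => exact (hst n).1

/-! ### The J-fraction of the generating function -/

/-- The tails of the J-fraction of `∑ C(n+1,3,a,b,t) zⁿ / (a+t)`. The denominators have constant
term `1`, so the inverses are true inverses. -/
def tailSeries (a b t : K) (k : ℕ) : PowerSeries K :=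
  let f := catSeries 3 a b
  let u := (((k / 3 : ℕ) : K) + 1) * a + t
  let e := 1 + PowerSeries.C (b / u) * PowerSeries.X ^ 2 * f
  if k % 3 = 0 then f * e * (1 - PowerSeries.C (u - a) * PowerSeries.X * f)⁻¹
  else if k % 3 = 1 then f * e⁻¹
  else 1 - PowerSeries.C u * PowerSeries.X * f

theorem tailSeries_eq {a b t : K} (hat : ∀ n : ℕ, ((n : K) + 1) * a + t ≠ 0) {σ θ : ℕ → K}
    (h : HasModThreeValues a b t σ θ) (k : ℕ) :
    tailSeries a b t k = 1 + PowerSeries.C (σ k) * PowerSeries.X * tailSeries a b t k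
      + PowerSeries.C (θ k) * PowerSeries.X ^ 2 * tailSeries a b t k * tailSeries a b t (k + 1) := by
  have hf := catSeries_eq 3 (by norm_num) a b
  set f := catSeries 3 a b with hfd
  have hβ (n : ℕ) : PowerSeries.C (b / (((n : K) + 1) * a + t)) *
      PowerSeries.C (((n : K) + 1) * a + t) = PowerSeries.C b := by
    rw [← map_mul, div_mul_cancel₀ _ (hat n)]
  have hD (n : ℕ) := PowerSeries.mul_inv_cancel
    (1 - PowerSeries.C (((n : K) + 1) * a + t - a) * PowerSeries.X * f) (by simp)
  have hE (n : ℕ) := PowerSeries.mul_inv_cancel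
    (1 + PowerSeries.C (b / (((n : K) + 1) * a + t)) * PowerSeries.X ^ 2 * f) (by simp)
  obtain ⟨n, hn⟩ : ∃ n, n = k / 3 := ⟨_, rfl⟩
  obtain ⟨h0, h1, h2, h3, h4, h5⟩ := h n
  have hk : k = 3 * n ∨ k = 3 * n + 1 ∨ k = 3 * n + 2 := by omega
  rcases hk with rfl | rfl | rfl
  · have e1 : (3 * n + 1) / 3 = n := by omega
    have e2 : (3 * n + 1) % 3 = 1 := by omega
    have e3 : (3 * n) % 3 = 0 := by omega
    simp only [tailSeries, e1, e2, e3, ← hn, if_true, one_ne_zero, if_false, ← hfd, h0, h3]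
    specialize hβ n; specialize hD n; specialize hE n
    rw [map_sub] at hD ⊢
    generalize PowerSeries.C (((n : K) + 1) * a + t) = u at *
    generalize PowerSeries.C (b / (((n : K) + 1) * a + t)) = β at *
    generalize (1 + β * PowerSeries.X ^ 2 * f)⁻¹ = e at *
    generalize (1 - (u - PowerSeries.C a) * PowerSeries.X * f)⁻¹ = i at *
    linear_combination (-β * PowerSeries.X ^ 2 * f ^ 2 * i) * hE + i * hf + hD
      - PowerSeries.X ^ 3 * f ^ 2 * i * hβ
  · have e1 : (3 * n + 1) / 3 = n := by omega
    have e2 : (3 * n + 1) % 3 = 1 := by omega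
    have e3 : (3 * n + 1 + 1) / 3 = n := by omega
    have e4 : (3 * n + 1 + 1) % 3 = 2 := by omega
    simp only [tailSeries, e1, e2, e3, e4, if_true, one_ne_zero, if_false, ← hfd, h1, h4,
      OfNat.ofNat_ne_zero, OfNat.ofNat_ne_one, map_neg]
    specialize hβ n; specialize hE n
    generalize PowerSeries.C (((n : K) + 1) * a + t) = u at *
    generalize PowerSeries.C (b / (((n : K) + 1) * a + t)) = β at *
    generalize (1 + β * PowerSeries.X ^ 2 * f)⁻¹ = e at *
    linear_combination e * hf + hE - PowerSeries.X ^ 3 * f ^ 2 * e * hβ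
  · have e1 : (3 * n + 2) / 3 = n := by omega
    have e2 : (3 * n + 2) % 3 = 2 := by omega
    have e3 : (3 * n + 2 + 1) / 3 = n + 1 := by omega
    have e4 : (3 * n + 2 + 1) % 3 = 0 := by omega
    have hu : (((n + 1 : ℕ) : K) + 1) * a + t = ((n : K) + 1) * a + t + a := by push_cast; ring
    have hu' : ((n : K) + 2) * a + t = ((n : K) + 1) * a + t + a := by ring
    have hu'' : -(((n : K) + 1) * a) - t = -(((n : K) + 1) * a + t) := by ring
    simp only [tailSeries, e1, e2, e3, e4, if_true, if_false, ← hfd, h2, h5, hu',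
      OfNat.ofNat_ne_zero, OfNat.ofNat_ne_one, hu'', map_neg, map_mul]
    have hβ := hβ (n + 1)
    have hD := hD (n + 1)
    rw [hu, map_add] at hβ
    simp only [hu, add_sub_cancel_right, map_add] at hβ hD ⊢
    generalize PowerSeries.C (b / (((n : K) + 1) * a + t + a)) = β at *
    generalize PowerSeries.C (((n : K) + 1) * a) + PowerSeries.C t = u at *
    generalize (1 - u * PowerSeries.X * f)⁻¹ = i at *
    linear_combination (-u * PowerSeries.X) * hf
      + u * (u + PowerSeries.C a) * PowerSeries.X ^ 2 * f * (1 + β * PowerSeries.X ^ 2 * f) * hD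
      + u * PowerSeries.X ^ 4 * f ^ 2 * hβ

theorem genCat_succ_eq {a b t : K} (hat : a + t ≠ 0) (n : ℕ) :
    genCat (n + 1) 3 a b t = (a + t) * PowerSeries.coeff n (tailSeries a b t 0) := by
  have hf := catSeries_eq 3 (by norm_num) a b
  have hF := genCatSeries_mul 3 a b t
  have hD := PowerSeries.mul_inv_cancel
    (1 - PowerSeries.C t * PowerSeries.X * catSeries 3 a b) (by simp)
  have hβ : PowerSeries.C (b / (a + t)) * (PowerSeries.C a + PowerSeries.C t) =
      PowerSeries.C b := by
    rw [← map_add, ← map_mul, div_mul_cancel₀ _ hat]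
  have key : genCatSeries 3 a b t = 1 + PowerSeries.X *
      (PowerSeries.C (a + t) * tailSeries a b t 0) := by
    simp only [tailSeries, Nat.zero_div, Nat.zero_mod, if_true, Nat.cast_zero, zero_add, one_mul,
      add_sub_cancel_left, map_add]
    generalize PowerSeries.C (b / (a + t)) = β at *
    generalize catSeries 3 a b = f at *
    generalize (1 - PowerSeries.C t * PowerSeries.X * f)⁻¹ = i at *
    linear_combination i * hF + (1 - genCatSeries 3 a b t) * hD + i * hf
      - PowerSeries.X ^ 3 * f ^ 2 * i * hβ
  rw [genCat, key, map_add, PowerSeries.coeff_succ_X_mul, PowerSeries.coeff_C_mul]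
  simp [PowerSeries.coeff_one]

theorem HasModThreeValues.genCat_eq {a b t : K} (hat : ∀ n : ℕ, ((n : K) + 1) * a + t ≠ 0)
    {σ θ : ℕ → K} (h : HasModThreeValues a b t σ θ) (n : ℕ) :
    genCat (n + 1) 3 a b t = (a + t) * favardArray σ θ n 0 := by
  rw [genCat_succ_eq (by simpa using hat 0), favardArray_eq_coeff (tailSeries_eq hat h)]
  simp

theorem HasModThreeValues.ne_zero {a b t : K} (hb : b ≠ 0)
    (hat : ∀ n : ℕ, ((n : K) + 1) * a + t ≠ 0) {σ θ : ℕ → K}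
    (h : HasModThreeValues a b t σ θ) (k : ℕ) : θ k ≠ 0 := by
  obtain ⟨-, -, -, h3, h4, h5⟩ := h (k / 3)
  have hk : k = 3 * (k / 3) ∨ k = 3 * (k / 3) + 1 ∨ k = 3 * (k / 3) + 2 := by omega
  rcases hk with hk | hk | hk <;> rw [hk]
  · rw [h3]
    exact div_ne_zero hb (hat _)
  · rw [h4]
    exact neg_ne_zero.mpr (div_ne_zero hb (hat _))
  · rw [h5]
    refine neg_ne_zero.mpr (mul_ne_zero (hat _) ?_)
    have := hat (k / 3 + 1)
    rwa [show (((k / 3 + 1 : ℕ) : K) + 1) = ((k / 3 : ℕ) : K) + 2 by push_cast; ring] at this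

theorem exists_hasModThreeValues (a b t : K) : ∃ σ θ : ℕ → K, HasModThreeValues a b t σ θ := by
  refine ⟨fun k => if k % 3 = 0 then ((k / 3 : ℕ) + 1) * a + t else if k % 3 = 1 then a
      else -(((k / 3 : ℕ) + 1) * a) - t,
    fun k => if k % 3 = 0 then b / (((k / 3 : ℕ) + 1) * a + t)
      else if k % 3 = 1 then -(b / (((k / 3 : ℕ) + 1) * a + t))
      else -((((k / 3 : ℕ) + 1) * a + t) * (((k / 3 : ℕ) + 2) * a + t)), fun n => ?_⟩
  have e0 : 3 * n / 3 = n := by omega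
  have e1 : (3 * n + 1) / 3 = n := by omega
  have e2 : (3 * n + 2) / 3 = n := by omega
  simp [e0, e1, e2, Nat.add_mod]

end

theorem theorem6p6 {K : Type*} [Field K] (a b t : K) (hb : b ≠ 0)
    (hat : ∀ n : ℕ, ((n : K) + 1) * a + t ≠ 0) :
    -- for every normalising constant `c ≠ 0`, in particular for `c = a` if `a ≠ 0`
    (∀ c : K, c ≠ 0 →
      (∀ n, hankelDet (fun k => genCat (k + 1) 3 a b t / c) n ≠ 0) ∧
      ∀ σ θ : ℕ → K,
        IsFavardCoeff (fun k => genCat (k + 1) 3 a b t / c) σ θ ↔ HasModThreeValues a b t σ θ) ∧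
    -- `c = a + t` makes the first term equal to `1`
    genCat 1 3 a b t = a + t ∧
    ∀ σ θ : ℕ → K,
      (∀ n, favardArray σ θ n 0 = genCat (n + 1) 3 a b t / (a + t)) ↔
        HasModThreeValues a b t σ θ := by
  obtain ⟨s₀, t₀, h₀⟩ := exists_hasModThreeValues a b t
  have hu : a + t ≠ 0 := by simpa using hat 0
  have hgen := h₀.genCat_eq hat
  have hμ (c : K) (n : ℕ) : genCat (n + 1) 3 a b t / c =
      (a + t) / c * favardArray s₀ t₀ n 0 := by rw [hgen, div_mul_eq_mul_div]
  have hn (c : K) (hc : c ≠ 0) (n : ℕ) : (a + t) / c * ∏ i ∈ Finset.range n, t₀ i ≠ 0 :=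
    mul_ne_zero (div_ne_zero hu hc) (Finset.prod_ne_zero_iff.mpr fun i _ => h₀.ne_zero hb hat i)
  have huniq {σ θ : ℕ → K} (h : HasModThreeValues a b t σ θ) : σ = s₀ ∧ θ = t₀ := by
    constructor <;> funext k <;>
      obtain ⟨a0, a1, a2, a3, a4, a5⟩ := h (k / 3) <;>
      obtain ⟨b0, b1, b2, b3, b4, b5⟩ := h₀ (k / 3) <;>
      have hk : k = 3 * (k / 3) ∨ k = 3 * (k / 3) + 1 ∨ k = 3 * (k / 3) + 2 := by omega
    · rcases hk with hk | hk | hk <;> rw [hk]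
      exacts [a0.trans b0.symm, a1.trans b1.symm, a2.trans b2.symm]
    · rcases hk with hk | hk | hk <;> rw [hk]
      exacts [a3.trans b3.symm, a4.trans b4.symm, a5.trans b5.symm]
  have hfav (c : K) (hc : c ≠ 0) := isFavardCoeff_of_favardArray (hμ c) (hn c hc)
  have hdet (c : K) (hc : c ≠ 0) (n : ℕ) :
      hankelDet (fun k => genCat (k + 1) 3 a b t / c) n ≠ 0 := by
    have ho := favardPoly_isMonicOrthogonal (hμ c) (hn c hc)
    rw [hankelDet_eq_prod _ ho.monic ho.natDegree_eq ho.orthogonal]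
    exact Finset.prod_ne_zero_iff.mpr fun i _ => ho.norm_ne_zero i
  refine ⟨fun c hc => ⟨hdet c hc, fun σ θ => ⟨fun h => ?_, fun h => ?_⟩⟩, ?_,
    fun σ θ => ⟨fun h => ?_, fun h n => ?_⟩⟩
  · obtain ⟨rfl, rfl⟩ := h.eq (hfav c hc)
    exact h₀
  · obtain ⟨rfl, rfl⟩ := huniq h
    exact hfav c hc
  · rw [hgen 0]
    simp [favardArray]
  · have h' (n : ℕ) : genCat (n + 1) 3 a b t / (a + t) = 1 * favardArray σ θ n 0 := by
      rw [one_mul, h]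
    -- the norms of the polynomials attached to `σ, θ` are factors of nonzero Hankel determinants
    have hθ (n : ℕ) : 1 * ∏ i ∈ Finset.range n, θ i ≠ 0 := by
      have hd := hdet (a + t) hu (n + 1)
      rw [hankelDet_eq_prod _ (fun n => (favardPoly_monic_natDegree σ θ n).1)
        (fun n => (favardPoly_monic_natDegree σ θ n).2)
        (fun _ _ => moment_favardPoly_mul_of_ne h')] at hd
      rw [← moment_favardPoly_mul_self h']
      exact Finset.prod_ne_zero_iff.mp hd n (Finset.self_mem_range_succ n)
    obtain ⟨rfl, rfl⟩ := (isFavardCoeff_of_favardArray h' hθ).eq (hfav (a + t) hu)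
    exact h₀
  · rw [h.genCat_eq hat, mul_div_cancel_left₀ _ hu]
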